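/- Let $n\ge 1$ and let $\boldsymbol{\alpha}=(\alpha_1,\dots,\alpha_n)\in\mathbb{Z}^n$ be a nonzero vector. Write $\|\boldsymbol{\alpha}\|$ for its Euclidean norm, $\gcd(\boldsymbol{\alpha})=\gcd(\alpha_1,\dots,\alpha_n)$, and $\boldsymbol{\alpha}\cdot\boldsymbol{\nu}=\alpha_1\nu_1+\dots+\alpha_n\nu_n$. There is a constant $C>0$, depending only on $\boldsymbol{\alpha}$ (and hence on $n$), such that the following holds for every real number $H\ge 1$, every box $\mathcal{B}=I_1\times\dots\times I_n\subseteq\mathbb{R}^n$, where each $I_i\subseteq\mathbb{R}$ is an interval (open, closed or half-open, possibly degenerate) of length at most $H$, and every integer $J$. The set $\{\boldsymbol{\nu}\in\mathcal{B}\cap\mathbb{Z}^n:\boldsymbol{\alpha}\cdot\boldsymbol{\nu}=J\}$ is finite. If $\gcd(\boldsymbol{\alpha})\nmid J$, then \[ \#\{\boldsymbol{\nu}\in\mathcal{B}\cap\mathbb{Z}^n:\boldsymbol{\alpha}\cdot\boldsymbol{\nu}=J\}=0. \] If $\gcd(\boldsymbol{\alpha})\mid J$, then the volume below is finite and \[ \left|\#\{\boldsymbol{\nu}\in\mathcal{B}\cap\mathbb{Z}^n:\boldsymbol{\alpha}\cdot\boldsymbol{\nu}=J\}-\frac{\gcd(\boldsymbol{\alpha})\operatorname{Vol}_{n-1}(\{\boldsymbol{x}\in\mathcal{B}:\boldsymbol{\alpha}\cdot\boldsymbol{x}=J\})}{\|\boldsymbol{\alpha}\|}\right|\le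 C\,H^{n-2}. \] Here $\operatorname{Vol}_{n-1}$ is the $(n-1)$-dimensional Lebesgue measure on the hyperplane $\{\boldsymbol{x}\in\mathbb{R}^n:\boldsymbol{\alpha}\cdot\boldsymbol{x}=J\}$ (counting measure if $n=1$). -/

import Mathlib

open MeasureTheory MeasureTheory.Measure

noncomputable section

/-- An integer vector, regarded as a point of Euclidean space. -/
def intPoint {n : ℕ} (ν : Fin n → ℤ) : EuclideanSpace ℝ (Fin n) :=
  WithLp.toLp 2 (fun i => (ν i : ℝ))

/-- `B` is an axis-parallel box, that is a product `I₁ × ⋯ × Iₙ` of bounded intervals (open, closed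
or half-open; degenerate intervals are allowed), each of length at most `H`.  An interval of `ℝ` is
an order-connected set, and it has length at most `H` iff any two of its points differ by at
most `H`. -/
def IsBoxWithSidesLE {n : ℕ} (B : Set (EuclideanSpace ℝ (Fin n))) (H : ℝ) : Prop :=
  ∃ I : Fin n → Set ℝ,
    (∀ i, (I i).OrdConnected) ∧ (∀ i, ∀ s ∈ I i, ∀ t ∈ I i, t - s ≤ H) ∧
      B = {x | ∀ i, x i ∈ I i}

/-- The integer points `ν` of `B` with `α · ν = J`. -/
def hyperplanePoints {n : ℕ} (α : Fin n → ℤ) (B : Set (EuclideanSpace ℝ (Fin n))) (J : ℤ) :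
    Set (Fin n → ℤ) :=
  {ν | intPoint ν ∈ B ∧ ∑ i, α i * ν i = J}

/-- The section of `B` by the real hyperplane `α · x = J`. -/
def hyperplaneSection {n : ℕ} (α : Fin n → ℤ) (B : Set (EuclideanSpace ℝ (Fin n))) (J : ℤ) :
    Set (EuclideanSpace ℝ (Fin n)) :=
  {x | x ∈ B ∧ ∑ i, (α i : ℝ) * x i = (J : ℝ)}

/-- The `(n - 1)`-dimensional volume of the section of `B` by the hyperplane `α · x = J`, as an
extended nonnegative real.  The Euclidean Hausdorff measure `μHE[d]` is the Hausdorff measure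
normalised so that on every `d`-dimensional affine subspace it is the Lebesgue measure (the counting
measure if `d = 0`). -/
def sectionVolume {n : ℕ} (α : Fin n → ℤ) (B : Set (EuclideanSpace ℝ (Fin n))) (J : ℤ) : ENNReal :=
  μHE[n - 1] (hyperplaneSection α B J)

/-- The greatest common divisor (nonnegative) of the coordinates. -/
def vecGcd {n : ℕ} (α : Fin n → ℤ) : ℤ := Finset.univ.gcd α

/-- The main term `gcd(α) · Vol_{n-1}(B ∩ {α · x = J}) / ‖α‖`, with the Euclidean norm `‖α‖`. -/
def mainTerm {n : ℕ} (α : Fin n → ℤ) (B : Set (EuclideanSpace ℝ (Fin n))) (J : ℤ) : ℝ :=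
  (vecGcd α : ℝ) * (sectionVolume α B J).toReal / ‖intPoint α‖

end

/-! Fix `p` with `α p ≠ 0`, put `q = |α p|` and `d = n - 1`, and forget the coordinate `p`. The
hyperplane is a graph over `ℝᵈ`, and the box section becomes a convex set `K` inside a cube of side
`2H`. The section has volume `‖α‖ / q` times that of `K` (`sectionVolume_eq`). A point of `ℤᵈ` lifts
to an integer solution iff its residue mod `q` solves a linear congruence, which has `g q ^ d / q`
solutions when `g = gcd(α)` divides `J` (`card_linear_congruence`). By
`bijOn_hyperplanePoints_residueClass`, each such class contributes the lattice points of a rescaled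
copy of `K`, namely `vol K / q ^ d` up to `O(H ^ (d - 1))`. Summing over the classes gives `g vol K
/ q`, the main term. The lattice point estimate compares counting with Lebesgue measure as product
measures, exchanging one factor at a time (`pi_le_pi_add`): on an interval the two differ by at most
one. -/

/-! ### Comparison of product measures. -/

open scoped ENNReal in
/-- Two product measures on `ℝᵈ` whose factors differ by at most one on intervals differ by at most
`d D ^ (d - 1)` on sets with order-connected coordinate sections inside a box whose sides have
measure at most `D`. -/
theorem pi_le_pi_add {D : ℝ≥0∞} : ∀ {d : ℕ} (μ ν : Fin d → Measure ℝ)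
    [∀ i, SigmaFinite (μ i)] [∀ i, SigmaFinite (ν i)] (S : Fin d → Set ℝ)
    (_ : ∀ i, MeasurableSet (S i))
    (_ : ∀ i, ∀ I : Set ℝ, I.OrdConnected → I ⊆ S i → μ i I ≤ ν i I + 1)
    (_ : ∀ i, μ i (S i) ≤ D) (_ : ∀ i, ν i (S i) ≤ D)
    (K : Set (Fin d → ℝ)) (_ : MeasurableSet K) (_ : K ⊆ Set.univ.pi S)
    (_ : ∀ x i, {t | Function.update x i t ∈ K}.OrdConnected),
    Measure.pi μ K ≤ Measure.pi ν K + d * D ^ (d - 1) := by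
  intro d
  induction d with
  | zero =>
    intro μ ν _ _ S _ _ _ _ K _ _ _
    rw [Measure.pi_of_empty μ (fun i => i.elim0), Measure.pi_of_empty ν (fun i => i.elim0)]
    simp
  | succ d ih =>
    intro μ ν _ _ S hS h hμ hν K hK hKS hsec
    let e := MeasurableEquiv.piFinSuccAbove (fun _ : Fin (d + 1) => ℝ) 0
    let K' : Set (ℝ × (Fin d → ℝ)) := e.symm ⁻¹' K
    have hK' : MeasurableSet K' := e.symm.measurable hK
    have memK' (t : ℝ) (y : Fin d → ℝ) : (t, y) ∈ K' ↔ (Fin.cons t y : Fin (d + 1) → ℝ) ∈ K := by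
      simp only [K', e, MeasurableEquiv.piFinSuccAbove, Set.mem_preimage]
      simp
      rfl
    have key (ρ : Fin (d + 1) → Measure ℝ) [∀ i, SigmaFinite (ρ i)] :
        Measure.pi ρ K = ((ρ 0).prod (Measure.pi fun j => ρ (Fin.succ j))) K' :=
      ((measurePreserving_piFinSuccAbove ρ 0).symm.measure_preimage_equiv K).symm
    set M := Measure.pi fun j => μ (Fin.succ j)
    set N := Measure.pi fun j => ν (Fin.succ j)
    let T : Set (Fin d → ℝ) := Set.univ.pi fun j => S j.succ
    have hT : MeasurableSet T := .univ_pi fun j => hS _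
    have hMT : M T ≤ D ^ d := by
      simp only [M, T, Measure.pi_pi]
      exact (Finset.prod_le_prod' fun i _ => hμ _).trans (by simp)
    -- Exchange factor 0: each line section over `y ∈ T` costs at most 1, so the total cost is `M
    -- T`.
    have step1 : ((μ 0).prod M) K' ≤ ((ν 0).prod M) K' + D ^ d := by
      rw [Measure.prod_apply_symm hK', Measure.prod_apply_symm hK']
      calc ∫⁻ y, μ 0 ((fun t => (t, y)) ⁻¹' K') ∂M
          ≤ ∫⁻ y, (ν 0 ((fun t => (t, y)) ⁻¹' K') + T.indicator 1 y) ∂M := by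
            refine lintegral_mono fun y => ?_
            by_cases hy : y ∈ T
            · rw [Set.indicator_of_mem hy]
              refine h 0 _ ?_ ?_
              · have := hsec (Fin.cons 0 y) 0
                simpa [memK', Set.preimage] using this
              · intro t ht
                have := hKS ((memK' t y).1 ht) 0 (Set.mem_univ _)
                simpa using this
            · have : (fun t => (t, y)) ⁻¹' K' = ∅ := by
                refine Set.eq_empty_of_forall_notMem fun t ht => hy fun j _ => ?_
                have := hKS ((memK' t y).1 ht) j.succ (Set.mem_univ _)
                simpa using this
              simp [this]
        _ = (∫⁻ y, ν 0 ((fun t => (t, y)) ⁻¹' K') ∂M) + M T := by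
            rw [lintegral_add_right _ (measurable_one.indicator hT), lintegral_indicator_one hT]
        _ ≤ _ := by gcongr
    -- Exchange the other factors slice by slice, by induction; integrating the error over `S 0`
    -- costs a further factor `D`.
    have step2 : ((ν 0).prod M) K' ≤ ((ν 0).prod N) K' + d * D ^ d := by
      rw [Measure.prod_apply hK', Measure.prod_apply hK']
      calc ∫⁻ t, M (Prod.mk t ⁻¹' K') ∂(ν 0)
          ≤ ∫⁻ t, (N (Prod.mk t ⁻¹' K') +
              (S 0).indicator (fun _ => (d * D ^ (d - 1) : ℝ≥0∞)) t) ∂(ν 0) := by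
            refine lintegral_mono fun t => ?_
            by_cases ht : t ∈ S 0
            · rw [Set.indicator_of_mem ht]
              refine ih (fun j => μ j.succ) (fun j => ν j.succ) (fun j => S j.succ)
                (fun _ => hS _) (fun _ => h _) (fun _ => hμ _) (fun _ => hν _) _
                (measurable_prodMk_left hK') ?_ ?_
              · intro y hy j _
                have := hKS ((memK' t y).1 hy) j.succ (Set.mem_univ _)
                simpa using this
              · intro y j
                have := hsec (Fin.cons t y) j.succ
                simpa [memK', Set.preimage, Fin.cons_update] using this
            · have : Prod.mk t ⁻¹' K' = ∅ := by
                refine Set.eq_empty_of_forall_notMem fun y hy => ht ?_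
                have := hKS ((memK' t y).1 hy) 0 (Set.mem_univ _)
                simpa using this
              simp [this]
        _ = (∫⁻ t, N (Prod.mk t ⁻¹' K') ∂(ν 0)) + d * D ^ (d - 1) * ν 0 (S 0) := by
            rw [lintegral_add_right _ (measurable_const.indicator (hS 0)),
              lintegral_indicator_const (hS 0)]
        _ ≤ (∫⁻ t, N (Prod.mk t ⁻¹' K') ∂(ν 0)) + d * D ^ (d - 1) * D := by
            gcongr; exact hν 0
        _ = _ := by
            -- For `d = 0` the exponent `d - 1` truncates, but the coefficient `d` vanishes.
            rcases d with _ | d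
            · simp
            · rw [mul_assoc, ← pow_succ]; simp
    rw [key μ, key ν]
    calc _ ≤ ((ν 0).prod N) K' + d * D ^ d + D ^ d := step1.trans (by gcongr)
      _ = _ := by push_cast; simp only [N]; ring

/-! ### Lattice points against volume. -/

/-- The counting measure of `ℤ`, as a measure on `ℝ`. -/
noncomputable def intCount : Measure ℝ := (count : Measure ℤ).map ((↑) : ℤ → ℝ)

theorem measurableEmbedding_intCast_real : MeasurableEmbedding ((↑) : ℤ → ℝ) :=
  Int.isClosedEmbedding_coe_real.measurableEmbedding

instance : SigmaFinite intCount := measurableEmbedding_intCast_real.sigmaFinite_map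

theorem intCount_apply (S : Set ℝ) : intCount S = ((((↑) : ℤ → ℝ) ⁻¹' S).encard : ENNReal) := by
  rw [intCount, measurableEmbedding_intCast_real.map_apply, count_apply (by measurability)]

theorem finite_preimage_intCast_of_subset_Icc {I : Set ℝ} {a b : ℝ} (h : I ⊆ Set.Icc a b) :
    (((↑) : ℤ → ℝ) ⁻¹' I).Finite := by
  refine (Set.finite_Icc ⌈a⌉ ⌊b⌋).subset fun k hk => ?_
  exact ⟨Int.ceil_le.2 (h hk).1, Int.le_floor.2 (h hk).2⟩

/-- The segment from the least to the greatest integer of `I` lies in `I`, and its length is at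
least the count minus one. -/
theorem intCount_le_volume_add_one {I : Set ℝ} (hI : I.OrdConnected) {a b : ℝ}
    (h : I ⊆ Set.Icc a b) : intCount I ≤ volume I + 1 := by
  have hfin := finite_preimage_intCast_of_subset_Icc h
  rw [intCount_apply]
  obtain ⟨s, hs⟩ := hfin.exists_finset_coe
  rw [← hs, Set.encard_coe_eq_coe_finsetCard]
  rcases s.eq_empty_or_nonempty with rfl | hne
  · simp
  have mem (k : ℤ) : k ∈ s ↔ (k : ℝ) ∈ I := by
    rw [← Finset.mem_coe, hs]; rfl
  have h0 := (mem _).1 (s.min'_mem hne)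
  have h1 := (mem _).1 (s.max'_mem hne)
  have hle : s.min' hne ≤ s.max' hne := s.min'_le_max' hne
  have hcard : (s.card : ℤ) ≤ s.max' hne - s.min' hne + 1 := by
    have := Finset.card_le_card (show s ⊆ Finset.Icc (s.min' hne) (s.max' hne) from
      fun k hk => Finset.mem_Icc.2 ⟨s.min'_le k hk, s.le_max' k hk⟩)
    rw [Int.card_Icc] at this
    omega
  have hvol : ENNReal.ofReal ((s.max' hne : ℝ) - s.min' hne) ≤ volume I := by
    rw [← Real.volume_Icc]
    exact measure_mono (hI.out h0 h1)
  calc ((s.card : ℕ∞) : ENNReal) = ENNReal.ofReal (s.card : ℝ) := by simp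
    _ ≤ ENNReal.ofReal ((s.max' hne : ℝ) - s.min' hne + 1) :=
      ENNReal.ofReal_le_ofReal (by exact_mod_cast hcard)
    _ = ENNReal.ofReal ((s.max' hne : ℝ) - s.min' hne) + 1 := by
      rw [ENNReal.ofReal_add (by rw [sub_nonneg]; exact_mod_cast hle) zero_le_one]; simp
    _ ≤ _ := by gcongr

/-- For `x, y ∈ I`, all integers from `⌈x⌉` to `⌊y⌋` lie in `I`, so the diameter of `I` is at most
the count plus one. -/
theorem volume_le_intCount_add_one {I : Set ℝ} (hI : I.OrdConnected) {a b : ℝ}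
    (h : I ⊆ Set.Icc a b) : volume I ≤ intCount I + 1 := by
  have hfin := finite_preimage_intCast_of_subset_Icc h
  rw [intCount_apply]
  obtain ⟨s, hs⟩ := hfin.exists_finset_coe
  rw [← hs, Set.encard_coe_eq_coe_finsetCard]
  have mem (k : ℤ) : k ∈ s ↔ (k : ℝ) ∈ I := by
    rw [← Finset.mem_coe, hs]; rfl
  have main (x : ℝ) (hx : x ∈ I) (y : ℝ) (hy : y ∈ I) : y - x ≤ s.card + 1 := by
    have := Finset.card_le_card (show Finset.Icc ⌈x⌉ ⌊y⌋ ⊆ s from fun k hk => by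
      rw [Finset.mem_Icc] at hk
      exact (mem k).2 (hI.out hx hy ⟨Int.ceil_le.1 hk.1, Int.le_floor.1 hk.2⟩))
    rw [Int.card_Icc] at this
    have h2 : ⌊y⌋ + 1 - ⌈x⌉ ≤ (s.card : ℤ) := by omega
    have h3 : (⌊y⌋ : ℝ) + 1 - ⌈x⌉ ≤ s.card := by exact_mod_cast h2
    linarith [Int.lt_floor_add_one y, Int.ceil_lt_add_one x]
  refine (Real.volume_le_diam I).trans (Metric.ediam_le fun x hx y hy => ?_)
  rw [edist_dist, Real.dist_eq]
  calc ENNReal.ofReal |x - y| ≤ ENNReal.ofReal (s.card + 1) :=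
        ENNReal.ofReal_le_ofReal (abs_sub_le_iff.2 ⟨main y hy x hx, main x hx y hy⟩)
    _ = _ := by rw [ENNReal.ofReal_add (by positivity) zero_le_one]; simp

/-- The points of the integer lattice in a subset of `ℝᵈ`. -/
def latticePoints {d : ℕ} (K : Set (Fin d → ℝ)) : Set (Fin d → ℤ) :=
  {m | (fun i => (m i : ℝ)) ∈ K}

theorem pi_intCount_apply {d : ℕ} {K : Set (Fin d → ℝ)} (hK : MeasurableSet K) :
    Measure.pi (fun _ : Fin d => intCount) K = ((latticePoints K).encard : ENNReal) := by
  have h1 : Measure.pi (fun _ : Fin d => intCount) =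
      (Measure.pi fun _ : Fin d => (count : Measure ℤ)).map fun x i => (x i : ℝ) := by
    have : SigmaFinite ((count : Measure ℤ).map ((↑) : ℤ → ℝ)) :=
      measurableEmbedding_intCast_real.sigmaFinite_map
    exact (Measure.pi_map_pi fun _ => measurableEmbedding_intCast_real.measurable.aemeasurable).symm
  have h2 : (Measure.pi fun _ : Fin d => (count : Measure ℤ)) = count :=
    Measure.ext_of_singleton fun m => by simp
  rw [h1, h2, Measure.map_apply (by fun_prop) hK, count_apply (by measurability)]
  rfl

/-- Counting integer points of a set with order-connected coordinate sections in a cube. -/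
theorem abs_ncard_latticePoints_sub_volume_le {d : ℕ} {K : Set (Fin d → ℝ)}
    (hK : MeasurableSet K) (hsec : ∀ x i, {t | Function.update x i t ∈ K}.OrdConnected)
    {c : Fin d → ℝ} {L : ℝ} (hL : 0 ≤ L) (hbox : ∀ x ∈ K, ∀ i, x i ∈ Set.Icc (c i) (c i + L)) :
    (latticePoints K).Finite ∧ volume K ≠ ⊤ ∧
      |((latticePoints K).ncard : ℝ) - (volume K).toReal| ≤ d * (L + 1) ^ (d - 1) := by
  let S : Fin d → Set ℝ := fun i => Set.Icc (c i) (c i + L)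
  have hKS : K ⊆ Set.univ.pi S := fun x hx i _ => hbox x hx i
  have hvS (i) : (volume : Measure ℝ) (S i) = ENNReal.ofReal L := by simp [S]
  have hcS (i) : intCount (S i) ≤ ENNReal.ofReal (L + 1) := by
    refine (intCount_le_volume_add_one Set.ordConnected_Icc subset_rfl).trans ?_
    rw [ENNReal.ofReal_add hL zero_le_one, ← hvS i]; simp [S]
  have hvS' (i) : (volume : Measure ℝ) (S i) ≤ ENNReal.ofReal (L + 1) := by
    rw [hvS]; exact ENNReal.ofReal_le_ofReal (by linarith)
  -- `L + 1` bounds both the length and the integer count of each side, so the comparison applies in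
  -- both directions.
  have A := pi_le_pi_add (fun _ => intCount) (fun _ => volume) S (fun _ => measurableSet_Icc)
    (fun i I hI hIS => intCount_le_volume_add_one hI hIS) hcS hvS' K hK hKS hsec
  have B := pi_le_pi_add (fun _ => volume) (fun _ => intCount) S (fun _ => measurableSet_Icc)
    (fun i I hI hIS => volume_le_intCount_add_one hI hIS) hvS' hcS K hK hKS hsec
  rw [pi_intCount_apply hK, ← volume_pi] at A B
  have hE : (d : ENNReal) * ENNReal.ofReal (L + 1) ^ (d - 1) =
      ENNReal.ofReal (d * (L + 1) ^ (d - 1)) := by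
    rw [ENNReal.ofReal_mul (by positivity), ENNReal.ofReal_pow (by positivity)]; simp
  rw [hE] at A B
  have hvK : volume K ≠ ⊤ := by
    refine ne_top_of_le_ne_top ?_ (measure_mono hKS)
    rw [volume_pi_pi]
    exact ENNReal.prod_ne_top fun i _ => by rw [hvS]; exact ENNReal.ofReal_ne_top
  have hfin : (latticePoints K).Finite := by
    rw [← Set.encard_ne_top_iff]
    intro htop
    rw [htop] at A
    exact ENNReal.add_ne_top.2 ⟨hvK, ENNReal.ofReal_ne_top⟩ 
      (by simpa only [ENat.toENNReal_top, top_le_iff] using A)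
  refine ⟨hfin, hvK, ?_⟩
  rw [← hfin.cast_ncard_eq] at A B
  have hpos : 0 ≤ (d : ℝ) * (L + 1) ^ (d - 1) := by positivity
  have e : (((latticePoints K).ncard : ℕ∞) : ENNReal).toReal = (latticePoints K).ncard := by simp
  rw [abs_sub_le_iff, ← e]
  constructor
  · have := ENNReal.toReal_mono (ENNReal.add_ne_top.2 ⟨hvK, ENNReal.ofReal_ne_top⟩) A
    rw [ENNReal.toReal_add hvK ENNReal.ofReal_ne_top, ENNReal.toReal_ofReal hpos] at this
    linarith
  · have := ENNReal.toReal_mono (ENNReal.add_ne_top.2 ⟨by simp, ENNReal.ofReal_ne_top⟩) B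
    rw [ENNReal.toReal_add (by simp) ENNReal.ofReal_ne_top, ENNReal.toReal_ofReal hpos] at this
    linarith

/-! ### Linear congruences. -/

/-- The number of solutions of a linear congruence modulo `q` whose coefficients generate, together
with `q`, the ideal `(g)`. -/
theorem card_linear_congruence {d q g : ℕ} [NeZero q] (hgq : g ∣ q) (β : Fin d → ℤ)
    (hβ : ∀ i, (g : ℤ) ∣ β i) (hbez : ∃ x : Fin d → ℤ, (q : ℤ) ∣ ∑ i, β i * x i - g)
    {J : ℤ} (hJ : (g : ℤ) ∣ J) :
    q * (Finset.univ.filter fun r : Fin d → ZMod q => ∑ i, (β i : ZMod q) * r i = J).card =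
      g * q ^ d := by
  let φ : (Fin d → ZMod q) →+ ZMod q :=
    { toFun := fun r => ∑ i, (β i : ZMod q) * r i
      map_zero' := by simp
      map_add' := fun r s => by simp [mul_add, Finset.sum_add_distrib] }
  have hrange : φ.range = AddSubgroup.zmultiples (g : ZMod q) := by
    apply le_antisymm
    · rintro _ ⟨r, rfl⟩
      change ∑ i, (β i : ZMod q) * r i ∈ AddSubgroup.zmultiples (g : ZMod q)
      refine sum_mem fun i _ => ?_
      obtain ⟨c, hc⟩ := hβ i
      refine AddSubgroup.mem_zmultiples_iff.2 ⟨c * (r i).val, ?_⟩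
      simp [hc]; ring
    · rw [AddSubgroup.zmultiples_le]
      obtain ⟨x, hx⟩ := hbez
      refine ⟨fun i => x i, ?_⟩
      have := (ZMod.intCast_zmod_eq_zero_iff_dvd _ q).2 hx
      push_cast at this
      exact sub_eq_zero.1 this
  have hcard : Nat.card φ.range * g = q := by
    rw [hrange, Nat.card_zmultiples, ZMod.addOrderOf_coe _ (NeZero.ne q), Nat.gcd_eq_right hgq,
      Nat.div_mul_cancel hgq]
  have hJmem : (J : ZMod q) ∈ Set.range φ := by
    have : (J : ZMod q) ∈ φ.range := by
      obtain ⟨c, rfl⟩ := hJ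
      rw [hrange]
      exact AddSubgroup.mem_zmultiples_iff.2 ⟨c, by simp; ring⟩
    exact this
  -- Nonempty fibres are cosets of the kernel, and the image has `q / g` elements.
  have hfib : (Finset.univ.filter fun r => φ r = (J : ZMod q)).card = Nat.card φ.ker := by
    rw [AddMonoidHom.card_fiber_eq_of_mem_range φ hJmem ⟨0, map_zero φ⟩, ← Fintype.card_subtype,
      ← Nat.card_eq_fintype_card]
    rfl
  have htot : Nat.card φ.ker * Nat.card φ.range = q ^ d := by
    rw [← AddSubgroup.index_ker, AddSubgroup.card_mul_index]; simp
  change q * (Finset.univ.filter fun r => φ r = (J : ZMod q)).card = _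
  rw [hfib, ← htot]
  nth_rewrite 1 [← hcard]
  ring

/-! ### The hyperplane as a graph, and its Jacobian. -/

section Graph

variable {d : ℕ} (α : Fin (d + 1) → ℤ) (p : Fin (d + 1)) (J : ℤ)

/-- The point of the hyperplane `α · x = J` lying over `y`, with respect to the projection that
forgets the coordinate `p`. -/
noncomputable def hyperplaneLift (y : Fin d → ℝ) : EuclideanSpace ℝ (Fin (d + 1)) :=
  WithLp.toLp 2 (p.insertNth ((J - ∑ i, (α (p.succAbove i) : ℝ) * y i) / α p) y)

/-- The linear part of `hyperplaneLift`. -/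
noncomputable def hyperplaneLiftLinear :
    EuclideanSpace ℝ (Fin d) →ₗ[ℝ] EuclideanSpace ℝ (Fin (d + 1)) where
  toFun y := WithLp.toLp 2 (p.insertNth (-(∑ i, (α (p.succAbove i) : ℝ) * y i) / α p) y)
  map_add' x y := by
    ext i
    refine p.succAboveCases ?_ (fun j => ?_) i
    · simp [mul_add, Finset.sum_add_distrib]; ring
    · simp
  map_smul' c y := by
    ext i
    refine p.succAboveCases ?_ (fun j => ?_) i
    · simp only [PiLp.smul_apply, smul_eq_mul, Fin.insertNth_apply_same, RingHom.id_apply]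
      rw [Finset.sum_congr rfl fun i _ => mul_left_comm _ c _, ← Finset.mul_sum]
      ring
    · simp

variable {α p}

theorem norm_intPoint_sq {n : ℕ} (α : Fin n → ℤ) : ‖intPoint α‖ ^ 2 = ∑ i, (α i : ℝ) ^ 2 := by
  rw [EuclideanSpace.norm_sq_eq]
  simp [intPoint]

/-- The Gram matrix of the graph map is `1 + v vᵀ` with `v` the vector of ratios `α i / α p`, `i ≠
p`; its determinant is `1 + |v|²`. -/
theorem normDet_hyperplaneLiftLinear (hp : α p ≠ 0) :
    (hyperplaneLiftLinear α p).normDet = ‖intPoint α‖ / |(α p : ℝ)| := by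
  have hp' : (α p : ℝ) ≠ 0 := by exact_mod_cast hp
  rw [← sq_eq_sq₀ (LinearMap.normDet_nonneg _) (by positivity)]
  have := (hyperplaneLiftLinear α p).normDet_sq_eq_det_gram (EuclideanSpace.basisFun (Fin d) ℝ)
  rw [RCLike.ofReal_real_eq_id, id] at this
  rw [this]
  let v : Fin d → ℝ := fun i => α (p.succAbove i) / α p
  have hg : Matrix.gram ℝ (fun i => hyperplaneLiftLinear α p (EuclideanSpace.basisFun (Fin d) ℝ i))
      = 1 + Matrix.replicateCol Unit v * Matrix.replicateRow Unit v := by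
    ext i j
    simp only [Matrix.gram_apply, PiLp.inner_apply, Fin.sum_univ_succAbove _ p]
    simp [hyperplaneLiftLinear, v, Matrix.mul_apply, Matrix.one_apply, Pi.single_apply]
    ring
  rw [hg, Matrix.det_one_add_replicateCol_mul_replicateRow, div_pow, norm_intPoint_sq, sq_abs,
    Fin.sum_univ_succAbove _ p]
  simp only [dotProduct, v]
  rw [add_div, div_self (by positivity), Finset.sum_div]
  congr 1
  exact Finset.sum_congr rfl fun i _ => by ring

theorem hyperplaneSection_eq_image (hp : α p ≠ 0) (B : Set (EuclideanSpace ℝ (Fin (d + 1)))) :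
    hyperplaneSection α B J = hyperplaneLift α p J '' (hyperplaneLift α p J ⁻¹' B) := by
  have hp' : (α p : ℝ) ≠ 0 := by exact_mod_cast hp
  rw [Set.image_preimage_eq_inter_range]
  ext x
  refine and_congr_right fun _ => ?_
  simp only [Fin.sum_univ_succAbove _ p]
  constructor
  · intro h
    refine ⟨fun i => x (p.succAbove i), ?_⟩
    ext i
    refine p.succAboveCases ?_ (fun j => ?_) i
    · simp [hyperplaneLift]
      field_simp
      linarith
    · simp [hyperplaneLift]
  · rintro ⟨y, rfl⟩
    simp [hyperplaneLift]
    field_simp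
    ring

theorem sectionVolume_eq (hp : α p ≠ 0) (B : Set (EuclideanSpace ℝ (Fin (d + 1)))) :
    sectionVolume α B J =
      ENNReal.ofReal (‖intPoint α‖ / |(α p : ℝ)|) * volume (hyperplaneLift α p J ⁻¹' B) := by
  set K := hyperplaneLift α p J ⁻¹' B
  have himg : hyperplaneLift α p J '' K = (hyperplaneLift α p J 0 + ·) ''
      (hyperplaneLiftLinear α p '' (WithLp.ofLp ⁻¹' K)) := by
    rw [Set.image_image]
    have h : ∀ y : EuclideanSpace ℝ (Fin d),
        hyperplaneLift α p J 0 + hyperplaneLiftLinear α p y = hyperplaneLift α p J y.ofLp := by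
      intro y
      ext i
      refine p.succAboveCases ?_ (fun j => ?_) i
      · simp [hyperplaneLift, hyperplaneLiftLinear]; ring
      · simp [hyperplaneLift, hyperplaneLiftLinear]
    simp only [h]
    ext x
    constructor
    · rintro ⟨y, hy, rfl⟩
      exact ⟨WithLp.toLp 2 y, hy, rfl⟩
    · rintro ⟨y, hy, rfl⟩
      exact ⟨_, hy, rfl⟩
  have hvol : volume (WithLp.ofLp ⁻¹' K : Set (EuclideanSpace ℝ (Fin d))) = volume K :=
    (EuclideanSpace.volume_preserving_symm_measurableEquiv_toLp (Fin d)).measure_preimage_equiv K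
  have := (hyperplaneLiftLinear α p).euclideanHausdorffMeasure_image_eq_normDet_mul_volume
    (WithLp.ofLp ⁻¹' K)
  rw [finrank_euclideanSpace_fin, hvol, normDet_hyperplaneLiftLinear hp] at this
  rw [sectionVolume, hyperplaneSection_eq_image J hp, Nat.add_sub_cancel, himg,
    (isometry_add_left _).euclideanHausdorffMeasure_image, this]

end Graph

/-! ### Projected box sections and their residue classes. -/

theorem Convex.ordConnected_update {ι : Type*} [DecidableEq ι] {K : Set (ι → ℝ)}
    (hK : Convex ℝ K) (x : ι → ℝ) (i : ι) : {t | Function.update x i t ∈ K}.OrdConnected := by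
  rw [← convex_iff_ordConnected]
  intro s hs t ht a b ha hb hab
  have := hK hs ht ha hb hab
  rw [Set.mem_ofPred_eq]
  convert this using 1
  ext j
  by_cases hj : j = i
  · subst hj; simp
  · simp [hj, ← add_mul, hab]

section Box

variable {d : ℕ} {α : Fin (d + 1) → ℤ} {p : Fin (d + 1)} {B : Set (EuclideanSpace ℝ (Fin (d + 1)))}
  {H : ℝ}

theorem convex_preimage_hyperplaneLift (hB : IsBoxWithSidesLE B H) (J : ℤ) :
    Convex ℝ (hyperplaneLift α p J ⁻¹' B) := by
  obtain ⟨I, hI, -, rfl⟩ := hB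
  intro y hy z hz a b ha hb hab j
  have : hyperplaneLift α p J (a • y + b • z) j =
      a • hyperplaneLift α p J y j + b • hyperplaneLift α p J z j := by
    refine p.succAboveCases ?_ (fun i => ?_) j
    · simp only [hyperplaneLift, Fin.insertNth_apply_same, Pi.add_apply, Pi.smul_apply,
        smul_eq_mul, mul_add, Finset.sum_add_distrib, mul_left_comm _ a, mul_left_comm _ b,
        ← Finset.mul_sum]
      have hb : b = 1 - a := by linarith
      subst hb
      ring
    · simp [hyperplaneLift]
  rw [this]
  exact (convex_iff_ordConnected.2 (hI j)) (hy j) (hz j) ha hb hab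

theorem measurableSet_preimage_hyperplaneLift (hB : IsBoxWithSidesLE B H) (J : ℤ) :
    MeasurableSet (hyperplaneLift α p J ⁻¹' B) := by
  obtain ⟨I, hI, -, rfl⟩ := hB
  rw [Set.preimage_ofPred_eq, Set.ofPred_forall]
  refine MeasurableSet.iInter fun j => ?_
  suffices h : Measurable fun y => hyperplaneLift α p J y j from h (hI j).measurableSet
  refine p.succAboveCases ?_ (fun i => ?_) j
  · simp only [hyperplaneLift, Fin.insertNth_apply_same]
    fun_prop
  · simp only [hyperplaneLift, Fin.insertNth_apply_succAbove]
    fun_prop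

/-- The cube is centred at an arbitrary point of the projected section, hence side `2 * H`. -/
theorem exists_preimage_hyperplaneLift_subset (hB : IsBoxWithSidesLE B H) (J : ℤ) :
    ∃ c : Fin d → ℝ, ∀ y ∈ hyperplaneLift α p J ⁻¹' B, ∀ i, y i ∈ Set.Icc (c i) (c i + 2 * H) := by
  obtain ⟨I, -, hI, rfl⟩ := hB
  by_cases h : ∃ z, z ∈ hyperplaneLift α p J ⁻¹' {x | ∀ i, x i ∈ I i}
  · obtain ⟨z, hz⟩ := h
    refine ⟨fun i => z i - H, fun y hy i => ?_⟩
    have h1 := hI _ _ (hz (p.succAbove i)) _ (hy (p.succAbove i))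
    have h2 := hI _ _ (hy (p.succAbove i)) _ (hz (p.succAbove i))
    simp only [hyperplaneLift, Fin.insertNth_apply_succAbove] at h1 h2
    constructor <;> linarith
  · exact ⟨0, fun y hy => (h ⟨y, hy⟩).elim⟩

/-- Counting points of a residue class in the projection of a hyperplane section of a box. -/
theorem abs_ncard_residueClass_sub_le (hH : 0 ≤ H) (hB : IsBoxWithSidesLE B H) (J : ℤ) {q : ℕ}
    (hq : 0 < q) (r : Fin d → ℝ) :
    (latticePoints ((fun y => r + (q : ℝ) • y) ⁻¹' (hyperplaneLift α p J ⁻¹' B))).Finite ∧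
      volume (hyperplaneLift α p J ⁻¹' B) ≠ ⊤ ∧
      |((latticePoints ((fun y => r + (q : ℝ) • y) ⁻¹' (hyperplaneLift α p J ⁻¹' B))).ncard : ℝ) -
        (volume (hyperplaneLift α p J ⁻¹' B)).toReal / q ^ d| ≤ d * (2 * H + 1) ^ (d - 1) := by
  have hq' : (1 : ℝ) ≤ q := by exact_mod_cast hq
  have hq0 : (q : ℝ) ≠ 0 := by positivity
  have hconv := convex_preimage_hyperplaneLift (α := α) (p := p) hB J
  have hmeas := measurableSet_preimage_hyperplaneLift (α := α) (p := p) hB J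
  obtain ⟨c, hc⟩ := exists_preimage_hyperplaneLift_subset (α := α) (p := p) hB J
  set K := hyperplaneLift α p J ⁻¹' B
  have hvol : volume ((fun y => r + (q : ℝ) • y) ⁻¹' K) =
      ENNReal.ofReal ((q : ℝ) ^ d)⁻¹ * volume K := by
    have : (fun y => r + (q : ℝ) • y) ⁻¹' K = (fun y => (q : ℝ) • y) ⁻¹' ((fun y => r + y) ⁻¹' K) :=
      rfl
    rw [this, addHaar_preimage_smul _ hq0, measure_preimage_add, Module.finrank_fin_fun,
      abs_of_pos (by positivity)]
  have hpre : Convex ℝ ((fun y => r + (q : ℝ) • y) ⁻¹' K) := by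
    intro y hy z hz a b ha hb hab
    have := hconv hy hz ha hb hab
    have e : a • (r + (q : ℝ) • y) + b • (r + (q : ℝ) • z) = r + (q : ℝ) • (a • y + b • z) := by
      have hb : b = 1 - a := by linarith
      subst hb
      module
    rw [e] at this
    exact this
  -- Rescaling shrinks the cube to side `2 * H / q`; since `q ≥ 1`, side `2 * H` suffices.
  obtain ⟨h1, h2, h3⟩ := abs_ncard_latticePoints_sub_volume_le (L := 2 * H)
    (c := fun i => (c i - r i) / q)
    (hmeas.preimage (by fun_prop : Measurable fun y => r + (q : ℝ) • y))
    hpre.ordConnected_update (by positivity) (by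
      intro y hy i
      have := hc _ hy i
      simp only [Pi.add_apply, Pi.smul_apply, smul_eq_mul, Set.mem_Icc] at this
      rw [Set.mem_Icc, div_le_iff₀ (by positivity), ← tsub_le_iff_right,
        le_div_iff₀ (by positivity)]
      constructor <;> nlinarith)
  refine ⟨h1, ?_, ?_⟩
  · intro htop
    rw [hvol, htop, ENNReal.mul_top (by simp; positivity)] at h2
    exact h2 rfl
  · rwa [hvol, ENNReal.toReal_mul, ENNReal.toReal_ofReal (by positivity), inv_mul_eq_div] at h3

theorem hyperplaneLift_eq_intPoint (hp : α p ≠ 0) {J : ℤ} {ν : Fin (d + 1) → ℤ}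
    (h : ∑ i, α i * ν i = J) :
    hyperplaneLift α p J (fun i => (ν (p.succAbove i) : ℝ)) = intPoint ν := by
  have hp' : (α p : ℝ) ≠ 0 := by exact_mod_cast hp
  ext i
  refine p.succAboveCases ?_ (fun j => ?_) i
  · rw [Fin.sum_univ_succAbove _ p] at h
    simp only [hyperplaneLift, Fin.insertNth_apply_same, intPoint]
    rw [← h]
    push_cast
    field_simp
    ring
  · simp [hyperplaneLift, intPoint]

/-- Write the remaining coordinates as `r + q m`. The congruence on `r` is what makes the coordinate
`p`, solved from the equation, an integer. -/
theorem bijOn_hyperplanePoints_residueClass {q : ℕ} [NeZero q] (hq : (α p).natAbs = q) {J : ℤ}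
    {r : Fin d → ZMod q} (hr : ∑ i, (α (p.succAbove i) : ZMod q) * r i = J) :
    Set.BijOn (fun (ν : Fin (d + 1) → ℤ) i => ν (p.succAbove i) / q)
      {ν | ν ∈ hyperplanePoints α B J ∧ (fun i => (ν (p.succAbove i) : ZMod q)) = r}
      (latticePoints ((fun y => (fun i => ((r i).val : ℝ)) + (q : ℝ) • y) ⁻¹'
        (hyperplaneLift α p J ⁻¹' B))) := by
  have hp : α p ≠ 0 := by
    rw [← Int.natAbs_ne_zero, hq]
    exact NeZero.ne q
  have hdec (ν : Fin (d + 1) → ℤ) (hν : (fun i => (ν (p.succAbove i) : ZMod q)) = r) (i : Fin d) :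
      ν (p.succAbove i) = (r i).val + q * (ν (p.succAbove i) / q) := by
    rw [← hν, ZMod.val_intCast]
    exact (Int.emod_add_mul_ediv _ _).symm
  refine ⟨?_, ?_, ?_⟩
  · rintro ν ⟨⟨hνB, hνJ⟩, hν⟩
    rw [← hyperplaneLift_eq_intPoint hp hνJ] at hνB
    change hyperplaneLift α p J _ ∈ B
    convert hνB using 2
    ext i
    simp only [Pi.add_apply, Pi.smul_apply, smul_eq_mul]
    conv_rhs => rw [hdec ν hν i]
    push_cast
    rfl
  · rintro ν ⟨⟨_, hνJ⟩, hν⟩ ν' ⟨⟨_, hνJ'⟩, hν'⟩ h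
    have hs (i) : ν (p.succAbove i) = ν' (p.succAbove i) := by
      rw [hdec ν hν, hdec ν' hν', show ν (p.succAbove i) / q = ν' (p.succAbove i) / q from congrFun h i]
    ext i
    refine p.succAboveCases ?_ hs i
    rw [← hνJ', Fin.sum_univ_succAbove _ p, Fin.sum_univ_succAbove _ p] at hνJ
    simp only [hs] at hνJ
    exact mul_left_cancel₀ hp (add_right_cancel hνJ)
  · intro m hm
    let x : Fin d → ℤ := fun i => (r i).val + q * m i
    have hx : (fun i => (x i : ZMod q)) = r := by ext i; simp [x]
    have hdvd : α p ∣ J - ∑ i, α (p.succAbove i) * x i := by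
      rw [← Int.natAbs_dvd, hq, ← ZMod.intCast_zmod_eq_zero_iff_dvd]
      push_cast
      rw [← hr, sub_eq_zero]
      exact Finset.sum_congr rfl fun i _ => by rw [← hx]
    obtain ⟨t, ht⟩ := hdvd
    let ν : Fin (d + 1) → ℤ := p.insertNth t x
    have hνs (i) : ν (p.succAbove i) = x i := by simp [ν]
    have hνJ : ∑ i, α i * ν i = J := by
      rw [Fin.sum_univ_succAbove _ p]
      simp only [hνs]
      simp [ν, ← ht]
    refine ⟨ν, ⟨⟨?_, hνJ⟩, by simpa only [hνs] using hx⟩, ?_⟩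
    · rw [← hyperplaneLift_eq_intPoint hp hνJ]
      change hyperplaneLift α p J _ ∈ B at hm
      convert hm using 2
      ext i
      simp [hνs, x]
    · ext i
      have : ((r i).val : ℤ) / q = 0 :=
        Int.ediv_eq_zero_of_lt (by positivity) (by exact_mod_cast (r i).val_lt)
      simp only [hνs, x]
      rw [Int.add_mul_ediv_left _ _ (by exact_mod_cast NeZero.ne q), this, zero_add]

end Box

/-! ### Summation over residue classes. -/

theorem vecGcd_dvd_of_mem_hyperplanePoints {n : ℕ} {α : Fin n → ℤ}
    {B : Set (EuclideanSpace ℝ (Fin n))} {J : ℤ} {ν : Fin n → ℤ}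
    (hν : ν ∈ hyperplanePoints α B J) : vecGcd α ∣ J := by
  rw [← hν.2]
  exact Finset.dvd_sum fun i _ => (Finset.gcd_dvd (Finset.mem_univ i)).mul_right _

theorem theorem3p1 (n : ℕ) (α : Fin n → ℤ) (hα : α ≠ 0) :
    ∃ C : ℝ, 0 < C ∧
      ∀ H : ℝ, 1 ≤ H →
      ∀ B : Set (EuclideanSpace ℝ (Fin n)), IsBoxWithSidesLE B H →
      ∀ J : ℤ,
        (hyperplanePoints α B J).Finite ∧
        (¬ vecGcd α ∣ J → (hyperplanePoints α B J).ncard = 0) ∧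
        (vecGcd α ∣ J →
          sectionVolume α B J ≠ ⊤ ∧
          |((hyperplanePoints α B J).ncard : ℝ) - mainTerm α B J| ≤ C * H ^ ((n : ℤ) - 2)) := by
  obtain ⟨p, hp⟩ := Function.ne_iff.1 hα
  rcases n with _ | d
  · exact p.elim0
  replace hp : α p ≠ 0 := hp
  obtain ⟨q, hq⟩ : ∃ q, (α p).natAbs = q := ⟨_, rfl⟩
  have hq0 : 0 < q := by omega
  have : NeZero q := ⟨hq0.ne'⟩
  have hqα : |(α p : ℝ)| = q := by rw [← hq, Nat.cast_natAbs, Int.cast_abs]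
  -- At most `q ^ d` classes, each with error `d * (2 * H + 1) ^ (d - 1)`, where `2 * H + 1 ≤ 3 *
  -- H`; the `+ 1` keeps the constant positive when `d = 0`.
  refine ⟨q ^ d * (d * 3 ^ (d - 1)) + 1, by positivity, fun H hH B hB J => ?_⟩
  let red : (Fin (d + 1) → ℤ) → Fin d → ZMod q := fun ν i => (ν (p.succAbove i) : ZMod q)
  let R := Finset.univ.filter fun r : Fin d → ZMod q =>
    ∑ i, (α (p.succAbove i) : ZMod q) * r i = J
  let K := hyperplaneLift α p J ⁻¹' B
  let E : (Fin d → ZMod q) → Set (Fin d → ℤ) := fun r =>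
    latticePoints ((fun y => (fun i => ((r i).val : ℝ)) + (q : ℝ) • y) ⁻¹' K)
  have hbij (r) (hr : r ∈ R) :=
    bijOn_hyperplanePoints_residueClass (B := B) hq (Finset.mem_filter.1 hr).2
  have hmaps (ν) (hν : ν ∈ hyperplanePoints α B J) : red ν ∈ R := by
    rw [Finset.mem_filter]
    refine ⟨Finset.mem_univ _, ?_⟩
    have hself : (α p : ZMod q) = 0 := by
      rw [ZMod.intCast_zmod_eq_zero_iff_dvd, ← hq, Int.natAbs_dvd]
    rw [← hν.2, Fin.sum_univ_succAbove _ p]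
    simp [red, hself]
  have hcount (r : Fin d → ZMod q) := abs_ncard_residueClass_sub_le (α := α) (p := p)
    (zero_le_one.trans hH) hB J hq0 (fun i => ((r i).val : ℝ))
  have hfin : (hyperplanePoints α B J).Finite := by
    refine (R.finite_toSet.biUnion (t := fun r =>
      {ν | ν ∈ hyperplanePoints α B J ∧ red ν = r}) fun r hr => ?_).subset fun ν hν => ?_
    · exact (hbij r hr).finite_iff_finite.2 (hcount r).1
    · exact Set.mem_biUnion (hmaps ν hν) ⟨hν, rfl⟩
  refine ⟨hfin, fun hJ => ?_, fun hJ => ?_⟩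
  · rw [Set.ncard_eq_zero hfin]
    exact Set.eq_empty_of_forall_notMem fun ν hν => hJ (vecGcd_dvd_of_mem_hyperplanePoints hν)
  have hsum : (hyperplanePoints α B J).ncard = ∑ r ∈ R, (E r).ncard := by
    classical
    rw [Set.ncard_eq_toFinset_card _ hfin,
      Finset.card_eq_sum_card_fiberwise (f := red) (t := R) fun ν hν => by
        exact hmaps ν (by simpa using hν)]
    refine Finset.sum_congr rfl fun r hr => ?_
    rw [← (hbij r hr).ncard_eq, ← Set.ncard_coe_finset]
    congr 1
    ext ν
    simp [red]
  obtain ⟨g, hg⟩ : ∃ g : ℕ, vecGcd α = g :=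
    Int.eq_ofNat_of_zero_le (Int.nonneg_of_normalize_eq_self Finset.normalize_gcd)
  have hgα (i) : (g : ℤ) ∣ α i := hg ▸ Finset.gcd_dvd (Finset.mem_univ i)
  have hR : q * R.card = g * q ^ d := by
    refine card_linear_congruence ?_ (fun i => α (p.succAbove i)) (fun i => hgα _) ?_ (hg ▸ hJ)
    · rw [← hq]; exact Int.natCast_dvd.1 (hgα p)
    -- In a Bézout relation for all of `α`, the term at `p` vanishes mod `q`.
    · obtain ⟨x, hx⟩ := Finset.gcd_eq_sum_mul Finset.univ α
      refine ⟨fun i => x (p.succAbove i), ?_⟩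
      rw [← hg, vecGcd, hx, Fin.sum_univ_succAbove _ p, ← hq, Int.natAbs_dvd]
      exact ⟨-x p, by ring⟩
  have hnorm : ‖intPoint α‖ ≠ 0 := by
    intro h
    have h0 : intPoint α p = 0 := by rw [norm_eq_zero.1 h]; rfl
    exact hp (by simpa [intPoint] using h0)
  have hvK : volume K ≠ ⊤ := (hcount 0).2.1
  have hvol := sectionVolume_eq J hp B
  refine ⟨by rw [hvol]; exact ENNReal.mul_ne_top ENNReal.ofReal_ne_top hvK, ?_⟩
  have hq' : (q : ℝ) ≠ 0 := by positivity
  -- The norm in the Jacobian `‖α‖ / q` cancels against the denominator of the main term.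
  have hmain : mainTerm α B J = ∑ r ∈ R, (volume K).toReal / q ^ d := by
    have hR' : (q : ℝ) * R.card = g * q ^ d := by exact_mod_cast hR
    rw [mainTerm, hvol, hg, hqα, ENNReal.toReal_mul, ENNReal.toReal_ofReal (by positivity),
      Finset.sum_const, nsmul_eq_mul]
    change _ * (_ * (volume K).toReal) / _ = _
    push_cast
    field_simp
    linear_combination -(volume K).toReal * hR'
  rw [hmain, hsum, Nat.cast_sum, ← Finset.sum_sub_distrib]
  have hRcard : (R.card : ℝ) ≤ q ^ d := by
    have := Finset.card_le_univ R
    rw [Fintype.card_pi] at this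
    simp only [ZMod.card, Finset.prod_const, Finset.card_univ, Fintype.card_fin] at this
    exact_mod_cast this
  have hpow : (d : ℝ) * (2 * H + 1) ^ (d - 1) ≤
      d * 3 ^ (d - 1) * H ^ (((d + 1 : ℕ) : ℤ) - 2) := by
    rcases d with _ | d
    · simp
    · have : (((d + 1 + 1 : ℕ) : ℤ) - 2) = (d : ℕ) := by push_cast; ring
      rw [this, zpow_natCast, Nat.add_sub_cancel, mul_assoc, ← mul_pow]
      gcongr
      linarith
  calc |∑ r ∈ R, (((E r).ncard : ℝ) - (volume K).toReal / q ^ d)|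
      ≤ ∑ r ∈ R, |((E r).ncard : ℝ) - (volume K).toReal / q ^ d| := Finset.abs_sum_le_sum_abs _ _
    _ ≤ ∑ r ∈ R, (d : ℝ) * (2 * H + 1) ^ (d - 1) := Finset.sum_le_sum fun r _ => (hcount r).2.2
    _ = R.card * (d * (2 * H + 1) ^ (d - 1)) := by rw [Finset.sum_const, nsmul_eq_mul]
    _ ≤ q ^ d * (d * 3 ^ (d - 1) * H ^ (((d + 1 : ℕ) : ℤ) - 2)) := by gcongr
    _ ≤ _ := by
      rw [← mul_assoc, add_mul]
      have : 0 ≤ H ^ (((d + 1 : ℕ) : ℤ) - 2) := by positivity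
      linarith
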